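/- Let $\mathcal M=(S,A,T,R,\beta,L,\Phi)$ be a labeled Markov decision process with finite state space $S$, a nonempty finite set $A(s)$ of available actions at each state $s$, transition probabilities $T(s'|s,a)$, rewards $R(s,a,s')$ with $R(s,a):=\sum_{s'}T(s'|s,a)R(s,a,s')$, initial distribution $\beta$, and finitely many specifications $\Phi=\{(L_i,[l_i,u_i])\}_i$ with $L_i\subseteq S$. The transition graph of $\mathcal M$ has an edge $s\to s'$ iff $T(s'|s,a)>0$ for some $a\in A(s)$; that of a Markov chain has an edge $s\to s'$ iff its transition probability from $s$ to $s'$ is positive. A terminal strongly connected component (TSCC) is a strongly connected component of the transition graph that has no outgoing edges and is reachable from some state $s$ with $\beta_s>0$. Let $r(\mathcal M)$ be the union of all TSCCs of $\mathcal M$, and, for a stationary policy $\pi$ (a distribution $\pi(\cdot|s)$ on $A(s)$ for each $s$), let $r(\mathcal M_\pi)$ be the union of all TSCCs of the induced chain with transition function $T_\pi(s'|s)=\sum_{a\in A(s)}T(s'|s,a)\pi(a|s)$ and initial distribution $\beta$. The set of edge-preserving policies is $$\Pi_{EP}=\{\pi \text{ stationary}: r(\mathcal M_\pi)=r(\mathcal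 M),\ \pi(a|s)>0\ \ \forall s\in r(\mathcal M),\,a\in A(s)\}.$$ With $S_0\sim\beta$, the occupation measure of $\pi$ is $\mathrm{Pr}^\infty_\pi(s,a)=\lim_n\frac1n\sum_{t=1}^n\Pr(S_t=s,A_t=a)$ and its expected average reward is $R^\infty_\pi(\beta)=\liminf_n\frac1n\sum_{t=1}^n\mathbb E[R(S_t,A_t)]$. The policy $\pi$ meets the specifications if $l_i\le\sum_{s\in L_i}\sum_{a\in A(s)}\mathrm{Pr}^\infty_\pi(s,a)\le u_i$ for all $i$. For $\epsilon>0$ let $\mathrm{LP}_1(\epsilon)$ be the linear program: maximize $\sum_{s}\sum_{a\in A(s)}x_{sa}R(s,a)$ over $x=(x_{sa})$, $y=(y_{sa})$, $s\in S$, $a\in A(s)$, subject to - $\sum_s\sum_{a\in A(s)} x_{sa}T(s'|s,a)=\sum_{a\in A(s')}x_{s'a}$ for all $s'\in S$; - $\sum_s\sum_{a\in A(s)} y_{sa}T(s'|s,a)=\sum_{a\in A(s')}(x_{s'a}+y_{s'a})-\beta_{s'}$ for all $s'\in S$; - $\sum_{f\in S\setminus r(\mathcal M)}\sum_{a\in A(f)}x_{fa}=0$;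 - $x_{sa}\in[0,1]$, $y_{sa}\ge0$ for all $s\in S$, $a\in A(s)$; - $l_i\le\sum_{s\in L_i}\sum_{a\in A(s)}x_{sa}\le u_i$ for all $i$; - $x_{sa}\ge\epsilon$ for all $s\in r(\mathcal M)$, $a\in A(s)$. With $x_s=\sum_{a\in A(s)}x_{sa}$ and $y_s=\sum_{a\in A(s)}y_{sa}$, a policy $\pi(x,y)$ obtained from $(x,y)$ is a stationary policy with $\pi(a|s)=x_{sa}/x_s$ if $x_s>0$, $\pi(a|s)=y_{sa}/y_s$ if $x_s=0$ and $y_s>0$, and $\pi(\cdot|s)$ arbitrary otherwise. Then: 1. For every $\epsilon>0$, every policy obtained from a feasible solution of $\mathrm{LP}_1(\epsilon)$ is in $\Pi_{EP}$. 2. If $\pi\in\Pi_{EP}$ meets the specifications, then there are $\epsilon>0$ and $y$ such that $(\mathrm{Pr}^\infty_\pi,y)$ is feasible for $\mathrm{LP}_1(\epsilon)$. 3. Suppose that some policy in $\Pi_{EP}$ meets the specifications. Then $\mathrm{LP}_1(\epsilon)$ has an optimal solution for all sufficiently small $\epsilon>0$, the supremum below is finite, and if $\pi^*_\epsilon$ denotes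 any policy obtained from any optimal solution of $\mathrm{LP}_1(\epsilon)$, then $$\lim_{\epsilon\downarrow0}\Bigl(\sup\{R^\infty_\pi(\beta):\pi\in\Pi_{EP},\ \pi\text{ meets the specifications}\}-R^\infty_{\pi^*_\epsilon}(\beta)\Bigr)=0.$$ -/

import Mathlib

open Filter Topology

noncomputable section

/-- A Markov decision process with finite state space `S`, actions in `A`, and a nonempty finite
set `avail s` of available actions at every state `s`; `T s a s'` is `T(s' | s, a)`. Values of `T`
and `rew` at unavailable actions are irrelevant. -/
structure MDP (S A : Type*) [Fintype S] where
  avail : S → Finset A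
  avail_nonempty : ∀ s, (avail s).Nonempty
  T : S → A → S → ℝ
  T_nonneg : ∀ s, ∀ a ∈ avail s, ∀ s', 0 ≤ T s a s'
  T_sum : ∀ s, ∀ a ∈ avail s, ∑ s', T s a s' = 1
  rew : S → A → S → ℝ
  init : S → ℝ
  init_nonneg : ∀ s, 0 ≤ init s
  init_sum : ∑ s, init s = 1

/-- A labeled MDP: an MDP with finitely many steady-state specifications `(L_i, [l_i, u_i])`. -/
structure LMDP (S A : Type*) [Fintype S] extends MDP S A where
  numSpecs : ℕ
  label : Fin numSpecs → Finset S
  lo : Fin numSpecs → ℝ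
  hi : Fin numSpecs → ℝ

section Graph

variable {S : Type*}

/-- Strongly connected component of the directed graph with edge relation `E`: a maximal
(nonempty) set of vertices any two of which are joined by directed paths. -/
def IsSCC (E : S → S → Prop) (C : Set S) : Prop :=
  Maximal (fun D : Set S => D.Nonempty ∧ ∀ s ∈ D, ∀ s' ∈ D, Relation.ReflTransGen E s s') C

/-- Terminal strongly connected component: an SCC reachable from some initial state and without
outgoing edges. -/
def IsTSCC (E : S → S → Prop) (init : S → ℝ) (C : Set S) : Prop :=
  IsSCC E C ∧
  (∃ s, 0 < init s ∧ ∃ s' ∈ C, Relation.ReflTransGen E s s') ∧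
  (∀ s ∈ C, ∀ s', E s s' → s' ∈ C)

/-- The union of all TSCCs. -/
def tsccUnion (E : S → S → Prop) (init : S → ℝ) : Set S :=
  ⋃₀ {C : Set S | IsTSCC E init C}

end Graph

namespace MDP

variable {S A : Type*} [Fintype S] (M : MDP S A)

/-- Edges of the transition graph of the MDP. -/
def Edge (s s' : S) : Prop := ∃ a ∈ M.avail s, 0 < M.T s a s'

/-- The union `r(M)` of the TSCCs of the MDP. -/
def recurrentSet : Set S := tsccUnion M.Edge M.init

/-- `π s a` is `π(a | s)`; a stationary policy is a distribution over `A(s)` for each `s`. -/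
structure IsStationaryPolicy (π : S → A → ℝ) : Prop where
  nonneg : ∀ s a, 0 ≤ π s a
  support : ∀ s a, a ∉ M.avail s → π s a = 0
  sum_eq_one : ∀ s, ∑ a ∈ M.avail s, π s a = 1

/-- Transition function of the Markov chain induced by a policy. -/
def chainT (π : S → A → ℝ) (s s' : S) : ℝ := ∑ a ∈ M.avail s, M.T s a s' * π s a

/-- The union `r(M_π)` of the TSCCs of the Markov chain induced by `π`. -/
def chainRecurrentSet (π : S → A → ℝ) : Set S :=
  tsccUnion (fun s s' => 0 < M.chainT π s s') M.init

/-- Edge-preserving policies. -/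
def edgePreserving : Set (S → A → ℝ) :=
  {π | M.IsStationaryPolicy π ∧ M.chainRecurrentSet π = M.recurrentSet ∧
    ∀ s ∈ M.recurrentSet, ∀ a ∈ M.avail s, 0 < π s a}

/-- `Pr(S_t = s)` when `S_0` is distributed according to the initial distribution. -/
def stateLaw (π : S → A → ℝ) : ℕ → S → ℝ
  | 0 => M.init
  | t + 1 => fun s' => ∑ s, stateLaw π t s * M.chainT π s s'

/-- `Pr(S_t = s, A_t = a)`. -/
def stateActionLaw (π : S → A → ℝ) (t : ℕ) (s : S) (a : A) : ℝ := M.stateLaw π t s * π s a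

/-- `p` is the steady-state distribution (occupation measure) of `π`: the limit of the averages
over times `1, …, n` exists and equals `p`. -/
def HasOccupationMeasure (π p : S → A → ℝ) : Prop :=
  ∀ s a, Tendsto (fun n : ℕ => (1 / (n : ℝ)) * ∑ t ∈ Finset.Icc 1 n, M.stateActionLaw π t s a)
    atTop (𝓝 (p s a))

/-- `R(s, a)`. -/
def meanReward (s : S) (a : A) : ℝ := ∑ s', M.T s a s' * M.rew s a s'

/-- Expected average reward of a policy. -/
def avgReward (π : S → A → ℝ) : ℝ :=
  liminf (fun n : ℕ => (1 / (n : ℝ)) * ∑ t ∈ Finset.Icc 1 n,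
    ∑ s, ∑ a ∈ M.avail s, M.stateActionLaw π t s a * M.meanReward s a) atTop

/-- `x_s`, the sum of `x_{sa}` over the available actions. -/
def marg (x : S → A → ℝ) (s : S) : ℝ := ∑ a ∈ M.avail s, x s a

/-- `π` is a policy obtained from `(x, y)`; it is an arbitrary distribution over `A(s)` at the
states with `x_s = y_s = 0`. -/
structure IsInducedPolicy (x y π : S → A → ℝ) : Prop where
  stationary : M.IsStationaryPolicy π
  of_x : ∀ s, 0 < M.marg x s → ∀ a ∈ M.avail s, π s a = x s a / M.marg x s
  of_y : ∀ s, ¬ 0 < M.marg x s → 0 < M.marg y s → ∀ a ∈ M.avail s, π s a = y s a / M.marg y s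

open Classical in
/-- The constraint set `Q_0`. -/
structure MemQ0 (x y : S → A → ℝ) : Prop where
  stationary : ∀ s', ∑ s, ∑ a ∈ M.avail s, x s a * M.T s a s' = ∑ a ∈ M.avail s', x s' a
  flow : ∀ s', ∑ s, ∑ a ∈ M.avail s, y s a * M.T s a s' =
    ∑ a ∈ M.avail s', (x s' a + y s' a) - M.init s'
  transient : ∑ f with f ∉ M.recurrentSet, ∑ a ∈ M.avail f, x f a = 0
  x_mem : ∀ s, ∀ a ∈ M.avail s, x s a ∈ Set.Icc (0 : ℝ) 1
  y_nonneg : ∀ s, ∀ a ∈ M.avail s, 0 ≤ y s a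

/-- The objective of the linear program. -/
def objective (x : S → A → ℝ) : ℝ := ∑ s, ∑ a ∈ M.avail s, x s a * M.meanReward s a

end MDP

namespace LMDP

variable {S A : Type*} [Fintype S] (M : LMDP S A)

/-- The state-action distribution `p` satisfies all steady-state specifications. -/
def SatisfiesSpecs (p : S → A → ℝ) : Prop :=
  ∀ i, M.lo i ≤ ∑ s ∈ M.label i, ∑ a ∈ M.avail s, p s a ∧
    ∑ s ∈ M.label i, ∑ a ∈ M.avail s, p s a ≤ M.hi i

/-- The policy `π` meets the specifications: its steady-state distribution satisfies them. -/
def MeetsSpecs (π : S → A → ℝ) : Prop :=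
  ∃ p, M.HasOccupationMeasure π p ∧ M.SatisfiesSpecs p

/-- Feasible points of `LP_1(ε)`. -/
structure LPFeasible (ε : ℝ) (x y : S → A → ℝ) : Prop where
  memQ0 : M.MemQ0 x y
  specs : M.SatisfiesSpecs x
  lower : ∀ s ∈ M.recurrentSet, ∀ a ∈ M.avail s, ε ≤ x s a

/-- Optimal solutions of `LP_1(ε)`. -/
def LPOptimal (ε : ℝ) (x y : S → A → ℝ) : Prop :=
  M.LPFeasible ε x y ∧ ∀ x' y', M.LPFeasible ε x' y' → M.objective x' ≤ M.objective x

end LMDP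

end

/-!
A policy is governed by the ergodic limit `Q` of its transition matrix `P`, the Cesàro limit of the
powers of `P`: its long-run law is `βQ`, which charges exactly the terminal components.

If `(x, y)` is feasible with `x > 0` on `r(M)`, then the marginal of `x` is invariant and positive
on `r(M)`, so functions harmonic for the induced chain are constant along edges starting in `r(M)`.
Pairing the flow constraint with a harmonic function therefore makes `y` cancel, even on `r(M)`,
where `y` need not be proportional to the policy: the marginal of `x` and `β` agree on harmonic
functions. The columns of `Q` are harmonic, so the marginal of `x` is `βQ`.

Conversely, a flow certificate `y ≥ 0` with `y(1 - P) = β - βQ` exists by Farkas' lemma, because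
`Qh ≤ h` for every superharmonic `h`. Optimal solutions exist although `y` is unbounded: the
admissible `x` are those for which `β` minus the marginal of `x` lies in a finitely generated cone,
which is closed.
-/

section TerminalComponents

variable {S : Type*}

theorem mem_tsccUnion_iff (E : S → S → Prop) (init : S → ℝ) (s : S) :
    s ∈ tsccUnion E init ↔ (∃ s₀, 0 < init s₀ ∧ Relation.ReflTransGen E s₀ s) ∧
      ∀ s', Relation.ReflTransGen E s s' → Relation.ReflTransGen E s' s := by
  constructor
  · rintro ⟨C, ⟨⟨⟨_, hC⟩, _⟩, ⟨s₀, h₀, c, hc, hs₀c⟩, hclosed⟩, hs⟩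
    refine ⟨⟨s₀, h₀, hs₀c.trans (hC c hc s hs)⟩, fun s' hs' => hC s' ?_ s hs⟩
    induction hs' with
    | refl => exact hs
    | tail _ he ih => exact hclosed _ ih _ he
  · rintro ⟨⟨s₀, h₀, hs₀⟩, hrec⟩
    refine ⟨{s' | Relation.ReflTransGen E s s'}, ⟨⟨⟨⟨s, .refl⟩, ?_⟩, ?_⟩, ?_, ?_⟩, .refl⟩
    · exact fun u hu v hv => (hrec u hu).trans hv
    · exact fun D hD hle v hv => hD.2 s (hle .refl) v hv
    · exact ⟨s₀, h₀, s, .refl, hs₀⟩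
    · exact fun u hu v huv => Relation.ReflTransGen.tail hu huv

end TerminalComponents

open Matrix

section NonnegMatrix

variable {S : Type*} [Fintype S] {P : Matrix S S ℝ}

theorem exists_pos_of_sum_mul_pos {f g : S → ℝ} (hf : 0 ≤ f)
    (h : 0 < ∑ i, f i * g i) : ∃ i, 0 < f i ∧ 0 < g i := by
  obtain ⟨i, -, hi⟩ := Finset.exists_lt_of_sum_lt (Finset.sum_const_zero.trans_lt h)
  exact ⟨i, (pos_and_pos_or_neg_and_neg_of_mul_pos hi).resolve_right fun hneg =>
    hneg.1.not_ge (hf i)⟩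

theorem mulVec_mono (hP : ∀ i j, 0 ≤ P i j) : Monotone (P *ᵥ ·) := by
  intro h h' hle i
  exact Finset.sum_le_sum fun j _ =>
    mul_le_mul_of_nonneg_left (hle j) (hP i j)

theorem pos_of_superharmonic_of_reflTransGen (hP : ∀ i j, 0 ≤ P i j) {h : S → ℝ}
    (h_nonneg : 0 ≤ h) (hh : P *ᵥ h ≤ h) {s s' : S}
    (hs : Relation.ReflTransGen (0 < P · ·) s s') (hpos : 0 < h s') : 0 < h s := by
  induction hs using Relation.ReflTransGen.head_induction_on with
  | refl => exact hpos
  | @head s u hsu _ hu =>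
    calc 0 < P s u * h u := mul_pos hsu hu
      _ ≤ (P *ᵥ h) s := Finset.single_le_sum (f := fun i => P s i * h i)
          (fun i _ => mul_nonneg (hP s i) (h_nonneg i))
          (Finset.mem_univ u)
      _ ≤ h s := hh s

theorem pos_of_invariant_of_reflTransGen (hP : ∀ i j, 0 ≤ P i j) {X : S → ℝ}
    (X_nonneg : 0 ≤ X) (hX : X ᵥ* P = X) {s s' : S}
    (hs : Relation.ReflTransGen (0 < P · ·) s s') (hpos : 0 < X s) : 0 < X s' := by
  induction hs with
  | refl => exact hpos
  | @tail u s' _ hus' hu =>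
    calc 0 < X u * P u s' := mul_pos hu hus'
      _ ≤ (X ᵥ* P) s' := Finset.single_le_sum (f := fun i => X i * P i s')
          (fun i _ => mul_nonneg (X_nonneg i) (hP i s'))
          (Finset.mem_univ u)
      _ = X s' := congrFun hX s'

end NonnegMatrix

section StochasticMatrix

variable {S : Type*} [Fintype S] [DecidableEq S] {P Q : Matrix S S ℝ}

theorem isClosed_rowStochastic : IsClosed (rowStochastic ℝ S : Set (Matrix S S ℝ)) := by
  have hset : (rowStochastic ℝ S : Set (Matrix S S ℝ)) =
      {P | ∀ i j, 0 ≤ P i j} ∩ {P | P *ᵥ 1 = 1} :=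
    rfl
  rw [hset]
  simp only [Set.ofPred_forall]
  exact .inter (isClosed_iInter fun i => isClosed_iInter fun j =>
    isClosed_le continuous_const (by fun_prop)) (isClosed_eq (by fun_prop) continuous_const)

theorem isCompact_rowStochastic : IsCompact (rowStochastic ℝ S : Set (Matrix S S ℝ)) := by
  have hbox : IsCompact (Set.univ.pi fun _ => Set.univ.pi fun _ => Set.Icc 0 1 :
      Set (Matrix S S ℝ)) :=
    isCompact_univ_pi fun _ => isCompact_univ_pi fun _ => isCompact_Icc
  exact hbox.of_isClosed_subset isClosed_rowStochastic fun P hP i _ j _ =>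
    ⟨nonneg_of_mem_rowStochastic hP, le_one_of_mem_rowStochastic hP⟩

/-- The average of the powers `P ^ 1, …, P ^ n`. -/
noncomputable def cesaroMean (P : Matrix S S ℝ) (n : ℕ) : Matrix S S ℝ :=
  (1 / (n : ℝ)) • ∑ t ∈ Finset.Icc 1 n, P ^ t

theorem cesaroMean_mem {K : Set (Matrix S S ℝ)} (hK : Convex ℝ K) (hpow : ∀ t, P ^ t ∈ K)
    {n : ℕ} (hn : n ≠ 0) : cesaroMean P n ∈ K := by
  rw [cesaroMean, Finset.smul_sum]
  exact hK.sum_mem (fun _ _ => by positivity) (by simp [hn]) fun t _ => hpow t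

theorem mem_of_tendsto_cesaroMean {l : Filter ℕ} [l.NeBot] (hl : l ≤ atTop)
    (hQ : Tendsto (cesaroMean P) l (𝓝 Q)) {K : Set (Matrix S S ℝ)} (hconv : Convex ℝ K)
    (hclosed : IsClosed K) (hpow : ∀ t, P ^ t ∈ K) : Q ∈ K :=
  hclosed.mem_of_tendsto hQ <| ((eventually_ne_atTop 0).filter_mono hl).mono fun _ hn =>
    cesaroMean_mem hconv hpow hn

theorem commute_of_tendsto_cesaroMean {l : Filter ℕ} [l.NeBot]
    (hQ : Tendsto (cesaroMean P) l (𝓝 Q)) {X : Matrix S S ℝ} (hX : Commute X P) :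
    Commute X Q := by
  have hmean (n : ℕ) : X * cesaroMean P n = cesaroMean P n * X :=
    (Commute.sum_right _ _ _ fun t _ => hX.pow_right t).smul_right _
  exact tendsto_nhds_unique (hQ.const_mul X) (by simpa only [hmean] using hQ.mul_const X)

theorem tendsto_cesaroMean_mul_sub_one (hP : P ∈ rowStochastic ℝ S) :
    Tendsto (fun n => cesaroMean P n * (P - 1)) atTop (𝓝 0) := by
  have htelescope (n : ℕ) : cesaroMean P n * (P - 1) = (1 / (n : ℝ)) • (P ^ (n + 1) - P) := by
    rw [cesaroMean, smul_mul_assoc, ← Finset.Ico_add_one_right_eq_Icc,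
      geom_sum_Ico_mul _ (by lia), pow_one]
  simp only [htelescope]
  refine tendsto_pi_nhds.2 fun i => tendsto_pi_nhds.2 fun j =>
    squeeze_zero_norm (fun n => ?_) tendsto_one_div_atTop_nhds_zero_nat
  have hpow := pow_mem hP (n + 1)
  have hle : |(P ^ (n + 1)) i j - P i j| ≤ 1 :=
    abs_sub_le_of_nonneg_of_le (nonneg_of_mem_rowStochastic hpow)
      (le_one_of_mem_rowStochastic hpow) (nonneg_of_mem_rowStochastic hP)
      (le_one_of_mem_rowStochastic hP)
  rw [Matrix.smul_apply, Matrix.sub_apply, norm_smul, Real.norm_of_nonneg (by positivity)]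
  exact mul_le_of_le_one_right (by positivity) hle

theorem mul_eq_of_tendsto_cesaroMean {l : Filter ℕ} [l.NeBot] (hl : l ≤ atTop)
    (hP : P ∈ rowStochastic ℝ S) (hQ : Tendsto (cesaroMean P) l (𝓝 Q)) : Q * P = Q := by
  have h := tendsto_nhds_unique (hQ.mul_const (P - 1))
    ((tendsto_cesaroMean_mul_sub_one hP).mono_left hl)
  rwa [mul_sub, mul_one, sub_eq_zero] at h

theorem mul_eq_self_of_tendsto_cesaroMean {l : Filter ℕ} [l.NeBot] (hl : l ≤ atTop)
    (hQ : Tendsto (cesaroMean P) l (𝓝 Q)) {m : Type*} {X : Matrix m S ℝ} (hX : X * P = X) :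
    X * Q = X := by
  refine mem_of_tendsto_cesaroMean hl hQ (K := {M | X * M = X}) ?_
    (isClosed_eq (by fun_prop) continuous_const) fun t => ?_
  · intro M hM N hN a b _ _ hab
    rw [Set.mem_ofPred_eq] at *
    rw [Matrix.mul_add, Matrix.mul_smul, Matrix.mul_smul, hM, hN, ← add_smul, hab, one_smul]
  · rw [Set.mem_ofPred_eq]
    induction t with
    | zero => rw [pow_zero, Matrix.mul_one]
    | succ t ih => rw [pow_succ, ← Matrix.mul_assoc, ih, hX]

theorem cesaroMean_limit_unique {l l' : Filter ℕ} [l.NeBot] [l'.NeBot] (hl : l ≤ atTop)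
    (hl' : l' ≤ atTop) (hP : P ∈ rowStochastic ℝ S) {Q' : Matrix S S ℝ}
    (hQ : Tendsto (cesaroMean P) l (𝓝 Q)) (hQ' : Tendsto (cesaroMean P) l' (𝓝 Q')) :
    Q = Q' := by
  have hcomm : Commute Q' Q := commute_of_tendsto_cesaroMean hQ
    (commute_of_tendsto_cesaroMean hQ' (.refl P)).symm
  calc Q = Q * Q' :=
        (mul_eq_self_of_tendsto_cesaroMean hl' hQ' (mul_eq_of_tendsto_cesaroMean hl hP hQ)).symm
    _ = Q' * Q := hcomm.eq.symm
    _ = Q' := mul_eq_self_of_tendsto_cesaroMean hl hQ (mul_eq_of_tendsto_cesaroMean hl' hP hQ')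

/-- The Cesàro limit of the powers of a row-stochastic matrix (a junk value when the averages do
not converge). -/
noncomputable def ergodicLimit (P : Matrix S S ℝ) : Matrix S S ℝ := limUnder atTop (cesaroMean P)

theorem tendsto_cesaroMean (hP : P ∈ rowStochastic ℝ S) :
    Tendsto (cesaroMean P) atTop (𝓝 (ergodicLimit P)) := by
  have hmem : ∀ᶠ n in atTop, cesaroMean P n ∈ rowStochastic ℝ S :=
    (eventually_ne_atTop 0).mono fun _ hn =>
      cesaroMean_mem convex_rowStochastic (pow_mem hP) hn
  obtain ⟨Q, -, hQ⟩ := isCompact_rowStochastic.exists_mapClusterPt_of_frequently hmem.frequently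
  refine tendsto_nhds_limUnder ⟨Q, isCompact_rowStochastic.tendsto_nhds_of_unique_mapClusterPt
    hmem fun Q' _ hQ' => ?_⟩
  obtain ⟨U, hU, hUQ⟩ := mapClusterPt_iff_ultrafilter.1 hQ
  obtain ⟨U', hU', hUQ'⟩ := mapClusterPt_iff_ultrafilter.1 hQ'
  exact cesaroMean_limit_unique hU' hU hP hUQ' hUQ

theorem ergodicLimit_mem_rowStochastic (hP : P ∈ rowStochastic ℝ S) :
    ergodicLimit P ∈ rowStochastic ℝ S :=
  mem_of_tendsto_cesaroMean le_rfl (tendsto_cesaroMean hP) convex_rowStochastic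
    isClosed_rowStochastic (pow_mem hP)

theorem ergodicLimit_mul (hP : P ∈ rowStochastic ℝ S) : ergodicLimit P * P = ergodicLimit P :=
  mul_eq_of_tendsto_cesaroMean le_rfl hP (tendsto_cesaroMean hP)

theorem mul_ergodicLimit (hP : P ∈ rowStochastic ℝ S) : P * ergodicLimit P = ergodicLimit P :=
  (commute_of_tendsto_cesaroMean (tendsto_cesaroMean hP) (.refl P)).eq.trans (ergodicLimit_mul hP)

theorem vecMul_ergodicLimit_of_invariant (hP : P ∈ rowStochastic ℝ S) {v : S → ℝ}
    (hv : v ᵥ* P = v) : v ᵥ* ergodicLimit P = v := by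
  have hrow : replicateRow Unit v * P = replicateRow Unit v := by
    rw [← replicateRow_vecMul, hv]
  have h := mul_eq_self_of_tendsto_cesaroMean le_rfl (tendsto_cesaroMean hP) hrow
  rwa [← replicateRow_vecMul, replicateRow_inj] at h

theorem ergodicLimit_mulVec_le_of_superharmonic (hP : P ∈ rowStochastic ℝ S) {h : S → ℝ}
    (hh : P *ᵥ h ≤ h) : ergodicLimit P *ᵥ h ≤ h := by
  refine mem_of_tendsto_cesaroMean le_rfl (tendsto_cesaroMean hP) (K := {M | M *ᵥ h ≤ h}) ?_
    (isClosed_le (by fun_prop) continuous_const) fun t => ?_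
  · refine (convex_Iic h).is_linear_preimage (f := (· *ᵥ h))
      ⟨fun M N => add_mulVec M N h, fun c M => smul_mulVec c M h⟩
  · rw [Set.mem_ofPred_eq]
    induction t with
    | zero => rw [pow_zero, one_mulVec]
    | succ t ih =>
      rw [pow_succ', ← mulVec_mulVec]
      exact (mulVec_mono hP.1 ih).trans hh

theorem sum_invariant_mul_sq_sub_eq_zero (hP : P ∈ rowStochastic ℝ S) {X h : S → ℝ}
    (hX : X ᵥ* P = X) (hh : P *ᵥ h = h) :
    ∑ s, ∑ s', X s * P s s' * (h s' - h s) ^ 2 = 0 := by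
  have hsq : ∑ s, ∑ s', X s * P s s' * h s' ^ 2 = ∑ s, X s * h s ^ 2 := by
    rw [Finset.sum_comm]
    refine Finset.sum_congr rfl fun s' _ => ?_
    rw [← Finset.sum_mul]
    exact congrArg (· * h s' ^ 2) (congrFun hX s')
  have hrow (s : S) : ∑ s', X s * P s s' * (h s' - h s) ^ 2 =
      ∑ s', X s * P s s' * h s' ^ 2 - X s * h s ^ 2 := by
    have hhs : ∑ s', P s s' * h s' = h s := congrFun hh s
    calc ∑ s', X s * P s s' * (h s' - h s) ^ 2
        = ∑ s', (X s * P s s' * h s' ^ 2 - 2 * X s * h s * (P s s' * h s') +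
            X s * h s ^ 2 * P s s') := Finset.sum_congr rfl fun s' _ => by ring
      _ = ∑ s', X s * P s s' * h s' ^ 2 - X s * h s ^ 2 := by
          rw [Finset.sum_add_distrib, Finset.sum_sub_distrib, ← Finset.mul_sum, ← Finset.mul_sum,
            hhs, sum_row_of_mem_rowStochastic hP]
          ring
  rw [Finset.sum_congr rfl fun s _ => hrow s, Finset.sum_sub_distrib, hsq, sub_self]

theorem harmonic_eq_of_invariant_pos (hP : P ∈ rowStochastic ℝ S) {X h : S → ℝ}
    (X_nonneg : 0 ≤ X) (hX : X ᵥ* P = X) (hh : P *ᵥ h = h) {s s' : S} (hs : 0 < X s)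
    (hss' : Relation.ReflTransGen (0 < P · ·) s s') : h s' = h s := by
  induction hss' with
  | refl => rfl
  | @tail u s' hsu hus' ih =>
    have hterm_nonneg (i j : S) : 0 ≤ X i * P i j * (h j - h i) ^ 2 :=
      mul_nonneg (mul_nonneg (X_nonneg i) (nonneg_of_mem_rowStochastic hP)) (sq_nonneg _)
    have hrow := (Finset.sum_eq_zero_iff_of_nonneg fun i _ =>
      Finset.sum_nonneg fun j _ => hterm_nonneg i j).1
        (sum_invariant_mul_sq_sub_eq_zero hP hX hh) u (Finset.mem_univ u)
    have hterm := (Finset.sum_eq_zero_iff_of_nonneg fun j _ => hterm_nonneg u j).1 hrow s'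
      (Finset.mem_univ s')
    have hu : 0 < X u := pos_of_invariant_of_reflTransGen hP.1 X_nonneg hX hsu hs
    rw [mul_eq_zero, or_iff_right (mul_pos hu hus').ne', sq_eq_zero_iff, sub_eq_zero] at hterm
    exact hterm.trans ih

theorem mulVec_indicator_one_le (hP : P ∈ rowStochastic ℝ S) {D : Set S}
    (hD : ∀ s s', 0 < P s s' → s' ∈ D → s ∈ D) :
    P *ᵥ D.indicator 1 ≤ D.indicator 1 := by
  intro s
  by_cases hs : s ∈ D
  · calc (P *ᵥ D.indicator 1) s ≤ (P *ᵥ 1) s :=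
          mulVec_mono hP.1 (Set.indicator_le_self' fun _ _ => zero_le_one) s
      _ = D.indicator 1 s := by
          rw [one_vecMul_of_mem_rowStochastic hP, Set.indicator_of_mem hs]
  · refine (Finset.sum_eq_zero fun s' _ => ?_).le.trans
      (Set.indicator_nonneg (fun _ _ => zero_le_one) s)
    by_cases hss' : 0 < P s s'
    · exact mul_eq_zero_of_right _ (Set.indicator_of_notMem (fun hs' => hs (hD s s' hss' hs')) _)
    · exact mul_eq_zero_of_left
        ((not_lt.1 hss').antisymm (nonneg_of_mem_rowStochastic hP)) _

theorem reflTransGen_of_ergodicLimit_pos (hP : P ∈ rowStochastic ℝ S) {s s' : S}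
    (hpos : 0 < ergodicLimit P s s') : Relation.ReflTransGen (0 < P · ·) s s' := by
  by_contra hs
  let D : Set S := {u | Relation.ReflTransGen (0 < P · ·) u s'}
  have hsD : s ∉ D := hs
  have hs'D : s' ∈ D := .refl
  have hD : P *ᵥ D.indicator 1 ≤ D.indicator 1 :=
    mulVec_indicator_one_le hP fun _ _ hedge hreach => .head hedge hreach
  have h_nonneg (u : S) : 0 ≤ D.indicator (1 : S → ℝ) u :=
    Set.indicator_nonneg (fun _ _ => zero_le_one) u
  refine hpos.not_ge ?_
  calc ergodicLimit P s s' = ergodicLimit P s s' * D.indicator 1 s' := by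
        rw [Set.indicator_of_mem hs'D, Pi.one_apply, mul_one]
    _ ≤ (ergodicLimit P *ᵥ D.indicator 1) s :=
        Finset.single_le_sum (f := fun u => ergodicLimit P s u * D.indicator 1 u)
          (fun u _ => mul_nonneg
            (nonneg_of_mem_rowStochastic (ergodicLimit_mem_rowStochastic hP)) (h_nonneg u))
          (Finset.mem_univ s')
    _ ≤ D.indicator 1 s := ergodicLimit_mulVec_le_of_superharmonic hP hD s
    _ = 0 := Set.indicator_of_notMem hsD _

theorem mulVec_col_ergodicLimit (hP : P ∈ rowStochastic ℝ S) (s : S) :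
    P *ᵥ (ergodicLimit P).col s = (ergodicLimit P).col s := by
  conv_rhs => rw [← mul_ergodicLimit hP]
  rfl

theorem vecMul_row_ergodicLimit (hP : P ∈ rowStochastic ℝ S) (s : S) :
    (ergodicLimit P).row s ᵥ* P = (ergodicLimit P).row s := by
  conv_rhs => rw [← ergodicLimit_mul hP]
  rfl

theorem eq_vecMul_ergodicLimit (hP : P ∈ rowStochastic ℝ S) {X β : S → ℝ} (hX : X ᵥ* P = X)
    (h_eq : ∀ h, P *ᵥ h = h → X ⬝ᵥ h = β ⬝ᵥ h) : X = β ᵥ* ergodicLimit P := by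
  rw [← vecMul_ergodicLimit_of_invariant hP hX]
  exact funext fun s => h_eq _ (mulVec_col_ergodicLimit hP s)

theorem vecMul_ergodicLimit_vecMul (hP : P ∈ rowStochastic ℝ S) (β : S → ℝ) :
    (β ᵥ* ergodicLimit P) ᵥ* P = β ᵥ* ergodicLimit P := by
  rw [vecMul_vecMul, ergodicLimit_mul hP]

theorem vecMul_ergodicLimit_pos_iff (hP : P ∈ rowStochastic ℝ S) {β : S → ℝ} (hβ : 0 ≤ β)
    (s : S) : 0 < (β ᵥ* ergodicLimit P) s ↔ s ∈ tsccUnion (0 < P · ·) β := by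
  have hQ := ergodicLimit_mem_rowStochastic hP
  have hQ_nonneg (i j : S) : 0 ≤ ergodicLimit P i j := nonneg_of_mem_rowStochastic hQ
  have hcol := mulVec_col_ergodicLimit hP s
  have hX_nonneg : 0 ≤ β ᵥ* ergodicLimit P := fun i => nonneg_vecMul_of_mem_rowStochastic hQ hβ i
  have hX := vecMul_ergodicLimit_vecMul hP β
  rw [mem_tsccUnion_iff]
  constructor
  · intro hs
    obtain ⟨s₀, hs₀, hs₀s⟩ := exists_pos_of_sum_mul_pos hβ hs
    refine ⟨⟨s₀, hs₀, reflTransGen_of_ergodicLimit_pos hP hs₀s⟩, fun s' hss' => ?_⟩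
    obtain ⟨u, hu, hus⟩ := exists_pos_of_sum_mul_pos hX_nonneg
      (hs.trans_eq (congrFun (vecMul_ergodicLimit_of_invariant hP hX) s).symm)
    -- Columns of the limit are harmonic, hence constant along paths leaving recurrent states.
    have hs's : ergodicLimit P s' s = ergodicLimit P u s :=
      (harmonic_eq_of_invariant_pos hP hX_nonneg hX hcol hs hss').trans
        (harmonic_eq_of_invariant_pos hP hX_nonneg hX hcol hu
          (reflTransGen_of_ergodicLimit_pos hP hus))
    exact reflTransGen_of_ergodicLimit_pos hP (hus.trans_eq hs's.symm)
  · rintro ⟨⟨s₀, hs₀, hs₀s⟩, hrec⟩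
    obtain ⟨u, -, hsu⟩ : ∃ u ∈ Finset.univ, 0 < ergodicLimit P s u :=
      Finset.exists_lt_of_sum_lt (by simp [sum_row_of_mem_rowStochastic hQ])
    have hss : 0 < ergodicLimit P s s :=
      pos_of_invariant_of_reflTransGen hP.1 (hQ_nonneg s) (vecMul_row_ergodicLimit hP s)
        (hrec u (reflTransGen_of_ergodicLimit_pos hP hsu)) hsu
    have hs₀s : 0 < ergodicLimit P s₀ s :=
      pos_of_superharmonic_of_reflTransGen hP.1 (h := (ergodicLimit P).col s)
        (fun i => hQ_nonneg i s) hcol.le hs₀s hss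
    exact Finset.sum_pos' (fun i _ => mul_nonneg (hβ i) (hQ_nonneg i s))
      ⟨s₀, Finset.mem_univ s₀, mul_pos hs₀ hs₀s⟩

end StochasticMatrix

section FinitelyGeneratedCone

variable {ι E : Type*} [AddCommGroup E] [Module ℝ E]

theorem mem_pointedCone_hull_image_iff {v : ι → E} {t : Finset ι} {x : E} :
    x ∈ PointedCone.hull ℝ (v '' t) ↔
      ∃ y : ι → ℝ, (∀ i ∈ t, 0 ≤ y i) ∧ ∑ i ∈ t, y i • v i = x := by
  classical
  rw [PointedCone.hull, Submodule.mem_span_image_finset_iff_exists_fun']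
  constructor
  · rintro ⟨c, rfl⟩
    exact ⟨fun i => c i, fun i _ => (c i).2, rfl⟩
  · rintro ⟨y, hy, rfl⟩
    refine ⟨fun i => ⟨max (y i) 0, le_max_right _ _⟩, Finset.sum_congr rfl fun i hi => ?_⟩
    simp only [Nonneg.mk_smul, max_eq_left (hy i hi)]

-- Carathéodory's step: subtract multiples of the relation `g` until a first coefficient vanishes.
theorem exists_nonneg_combination_erase [DecidableEq ι] {v : ι → E} {t : Finset ι} {g y : ι → ℝ}
    (hg : ∑ i ∈ t, g i • v i = 0) (hpos : ∃ i ∈ t, 0 < g i) (hy : ∀ i ∈ t, 0 ≤ y i) :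
    ∃ j ∈ t, ∃ z : ι → ℝ, (∀ i ∈ t.erase j, 0 ≤ z i) ∧
      ∑ i ∈ t.erase j, z i • v i = ∑ i ∈ t, y i • v i := by
  obtain ⟨i₀, hi₀, hgi₀⟩ := hpos
  obtain ⟨j, hj, hmin⟩ := ({i ∈ t | 0 < g i} : Finset ι).exists_min_image (fun i => y i / g i)
    ⟨i₀, Finset.mem_filter.2 ⟨hi₀, hgi₀⟩⟩
  obtain ⟨hjt, hgj⟩ := Finset.mem_filter.1 hj
  refine ⟨j, hjt, fun i => y i - y j / g j * g i, fun i hi => ?_, ?_⟩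
  · have hit := Finset.mem_of_mem_erase hi
    rcases lt_or_ge 0 (g i) with hgi | hgi
    · exact sub_nonneg.2 ((le_div_iff₀ hgi).1 (hmin i (Finset.mem_filter.2 ⟨hit, hgi⟩)))
    · exact sub_nonneg.2 ((mul_nonpos_of_nonneg_of_nonpos (div_nonneg (hy j hjt) hgj.le) hgi).trans
        (hy i hit))
  · rw [Finset.sum_erase _ (by simp only [div_mul_cancel₀ _ hgj.ne', sub_self, zero_smul])]
    simp only [sub_smul, mul_smul, Finset.sum_sub_distrib, ← Finset.smul_sum, hg, smul_zero,
      sub_zero]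

theorem pointedCone_hull_image_eq_iUnion_erase [DecidableEq ι] {v : ι → E} {t : Finset ι}
    (ht : ¬ LinearIndepOn ℝ v (t : Set ι)) :
    (PointedCone.hull ℝ (v '' t) : Set E) =
      ⋃ j ∈ t, (PointedCone.hull ℝ (v '' (t.erase j)) : Set E) := by
  obtain ⟨g, hg, hpos⟩ : ∃ g : ι → ℝ, ∑ i ∈ t, g i • v i = 0 ∧ ∃ i ∈ t, 0 < g i := by
    rw [linearIndepOn_finset_iff] at ht
    push Not at ht
    obtain ⟨g, hg, i, hi, hgi⟩ := ht
    rcases hgi.lt_or_gt with hneg | hpos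
    · exact ⟨-g, by simp [hg], i, hi, neg_pos.2 hneg⟩
    · exact ⟨g, hg, i, hi, hpos⟩
  refine subset_antisymm (fun x hx => ?_) (Set.iUnion₂_subset fun j _ =>
    Submodule.span_mono (Set.image_mono (by simp)))
  obtain ⟨y, hy, rfl⟩ := mem_pointedCone_hull_image_iff.1 hx
  obtain ⟨j, hj, z, hz, hzx⟩ := exists_nonneg_combination_erase hg hpos hy
  exact Set.mem_iUnion₂.2 ⟨j, hj, mem_pointedCone_hull_image_iff.2 ⟨z, hz, hzx⟩⟩

theorem isClosed_pointedCone_hull_image [TopologicalSpace E] [IsTopologicalAddGroup E]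
    [ContinuousSMul ℝ E] [T2Space E] (v : ι → E) (t : Finset ι) :
    IsClosed (PointedCone.hull ℝ (v '' t) : Set E) := by
  classical
  induction t using Finset.strongInduction with
  | H t ih =>
    by_cases ht : LinearIndepOn ℝ v (t : Set ι)
    · have hemb := LinearMap.isClosedEmbedding_of_injective
        (LinearMap.ker_eq_bot.2 (linearIndependent_iff_injective_fintypeLinearCombination.1 ht))
      convert hemb.isClosedMap _ (isClosed_Ici (a := 0))
      ext x
      rw [SetLike.mem_coe, PointedCone.hull, Submodule.mem_span_image_finset_iff_exists_fun]
      constructor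
      · rintro ⟨c, rfl⟩
        exact ⟨fun i => c i, fun i => (c i).2, rfl⟩
      · rintro ⟨y, hy, rfl⟩
        exact ⟨fun i => ⟨y i, hy i⟩, rfl⟩
    · rw [pointedCone_hull_image_eq_iUnion_erase ht]
      exact t.finite_toSet.isClosed_biUnion fun j hj => ih _ (Finset.erase_ssubset hj)

theorem exists_nonneg_vecMul_eq {m n : Type*} [Fintype m] [Fintype n] {A : Matrix m n ℝ}
    {b : n → ℝ} (h : ∀ x, 0 ≤ A *ᵥ x → 0 ≤ b ⬝ᵥ x) : ∃ y, 0 ≤ y ∧ y ᵥ* A = b := by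
  classical
  let C : ProperCone ℝ (n → ℝ) :=
    ⟨PointedCone.hull ℝ (A.row '' (Finset.univ : Finset m)), isClosed_pointedCone_hull_image _ _⟩
  suffices hb : b ∈ C by
    obtain ⟨y, hy, rfl⟩ := mem_pointedCone_hull_image_iff.1 hb
    exact ⟨y, fun i => hy i (Finset.mem_univ i), vecMul_eq_sum _ _⟩
  by_contra hb
  obtain ⟨f, hfC, hfb⟩ := ProperCone.hyperplane_separation_point C hb
  have hf (x : n → ℝ) : f x = x ⬝ᵥ fun j => f (Pi.single j 1) := by
    conv_lhs => rw [pi_eq_sum_univ' x]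
    simp [dotProduct, map_sum]
  refine hfb.not_ge (hf b ▸ h _ fun i => ?_)
  exact (hfC (A.row i) (PointedCone.subset_hull (by simp))).trans_eq (hf _)

end FinitelyGeneratedCone

theorem exists_nonneg_vecMul_one_sub_eq {S : Type*} [Fintype S] [DecidableEq S]
    {P : Matrix S S ℝ} (hP : P ∈ rowStochastic ℝ S) {β : S → ℝ} (hβ : 0 ≤ β) :
    ∃ y, 0 ≤ y ∧ y ᵥ* (1 - P) = β - β ᵥ* ergodicLimit P := by
  refine exists_nonneg_vecMul_eq fun h hh => ?_
  have h_super : P *ᵥ h ≤ h := by rwa [sub_mulVec, one_mulVec, sub_nonneg] at hh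
  rw [sub_dotProduct, ← dotProduct_mulVec, ← dotProduct_sub]
  exact dotProduct_nonneg_of_nonneg hβ
    (sub_nonneg.2 (ergodicLimit_mulVec_le_of_superharmonic hP h_super))

theorem tendsto_of_isLUB {α ι : Type*} [LinearOrder α] [TopologicalSpace α] [OrderTopology α]
    {s : Set α} {V : α} {l : Filter ι} {f : ι → α} (hV : IsLUB s V) (hf : ∀ᶠ i in l, f i ∈ s)
    (hle : ∀ r ∈ s, ∀ᶠ i in l, r ≤ f i) : Tendsto f l (𝓝 V) := by
  refine tendsto_order.2 ⟨fun r hr => ?_, fun r hr => hf.mono fun i hi => (hV.1 hi).trans_lt hr⟩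
  obtain ⟨r', hr', hlt⟩ := (lt_isLUB_iff hV).1 hr
  exact (hle r' hr').mono fun i hi => hlt.trans_le hi

namespace MDP

variable {S A : Type*} [Fintype S] {M : MDP S A} {x x' y π : S → A → ℝ}

/-- The transition matrix of the Markov chain induced by a policy. -/
def chainMatrix (M : MDP S A) (π : S → A → ℝ) : Matrix S S ℝ := Matrix.of (M.chainT π)

theorem chainMatrix_pos (hπ : M.IsStationaryPolicy π) {s s' : S} {a : A} (ha : a ∈ M.avail s)
    (hT : 0 < M.T s a s') (hpos : 0 < π s a) : 0 < M.chainMatrix π s s' :=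
  Finset.sum_pos' (fun b hb => mul_nonneg (M.T_nonneg s b hb s') (hπ.nonneg s b))
    ⟨a, ha, mul_pos hT hpos⟩

theorem chainMatrix_mulVec (h : S → ℝ) (s : S) :
    (M.chainMatrix π *ᵥ h) s = ∑ a ∈ M.avail s, π s a * (M.T s a ⬝ᵥ h) := by
  simp only [mulVec, dotProduct, chainMatrix, Matrix.of_apply, chainT, Finset.sum_mul,
    Finset.mul_sum]
  rw [Finset.sum_comm]
  exact Finset.sum_congr rfl fun a _ => Finset.sum_congr rfl fun s' _ => by ring

theorem vecMul_chainMatrix (v : S → ℝ) (s' : S) :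
    (v ᵥ* M.chainMatrix π) s' = ∑ s, ∑ a ∈ M.avail s, v s * π s a * M.T s a s' := by
  simp only [vecMul, dotProduct, chainMatrix, Matrix.of_apply, chainT, Finset.mul_sum]
  exact Finset.sum_congr rfl fun s _ => Finset.sum_congr rfl fun a _ => by ring

theorem sum_flow_mul (h : S → ℝ) :
    ∑ s', (∑ s, ∑ a ∈ M.avail s, y s a * M.T s a s') * h s' =
      ∑ s, ∑ a ∈ M.avail s, y s a * (M.T s a ⬝ᵥ h) := by
  simp only [Finset.sum_mul, dotProduct, Finset.mul_sum, ← mul_assoc]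
  rw [Finset.sum_comm]
  exact Finset.sum_congr rfl fun s _ => Finset.sum_comm

theorem T_dotProduct_eq {s : S} {a : A} (ha : a ∈ M.avail s) {h : S → ℝ} {c : ℝ}
    (hc : ∀ s', 0 < M.T s a s' → h s' = c) : M.T s a ⬝ᵥ h = c := by
  calc M.T s a ⬝ᵥ h = ∑ s', M.T s a s' * c := Finset.sum_congr rfl fun s' _ => by
        rcases (M.T_nonneg s a ha s').eq_or_lt with h0 | hpos
        · rw [← h0, zero_mul, zero_mul]
        · rw [hc s' hpos]
    _ = c := by rw [← Finset.sum_mul, M.T_sum s a ha, one_mul]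

namespace IsStationaryPolicy

theorem le_one (hπ : M.IsStationaryPolicy π) {s : S} {a : A} (ha : a ∈ M.avail s) : π s a ≤ 1 :=
  (Finset.single_le_sum (fun b _ => hπ.nonneg s b) ha).trans_eq (hπ.sum_eq_one s)

theorem marg_mul (hπ : M.IsStationaryPolicy π) (v : S → ℝ) :
    M.marg (fun s a => v s * π s a) = v :=
  funext fun s => by rw [marg, ← Finset.mul_sum, hπ.sum_eq_one, mul_one]

theorem chainMatrix_mem_rowStochastic [DecidableEq S] (hπ : M.IsStationaryPolicy π) :
    M.chainMatrix π ∈ rowStochastic ℝ S := by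
  refine ⟨fun s s' => Finset.sum_nonneg fun a ha =>
    mul_nonneg (M.T_nonneg s a ha s') (hπ.nonneg s a), funext fun s => ?_⟩
  rw [chainMatrix_mulVec, Pi.one_apply, ← hπ.sum_eq_one s]
  exact Finset.sum_congr rfl fun a ha => by
    rw [T_dotProduct_eq ha fun _ _ => Pi.one_apply _, mul_one]

end IsStationaryPolicy

section LongRunLaw

variable [DecidableEq S]

/-- The Cesàro limit of the state distributions of the Markov chain induced by a policy. -/
noncomputable def longRunLaw (M : MDP S A) (π : S → A → ℝ) : S → ℝ :=
  M.init ᵥ* ergodicLimit (M.chainMatrix π)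

theorem stateLaw_eq_vecMul (π : S → A → ℝ) (t : ℕ) :
    M.stateLaw π t = M.init ᵥ* M.chainMatrix π ^ t := by
  induction t with
  | zero => rw [pow_zero, vecMul_one]; rfl
  | succ t ih => rw [pow_succ, ← vecMul_vecMul, ← ih]; rfl

namespace IsStationaryPolicy

theorem longRunLaw_nonneg (hπ : M.IsStationaryPolicy π) : 0 ≤ M.longRunLaw π :=
  fun s => nonneg_vecMul_of_mem_rowStochastic
    (ergodicLimit_mem_rowStochastic hπ.chainMatrix_mem_rowStochastic) M.init_nonneg s

theorem longRunLaw_le_one (hπ : M.IsStationaryPolicy π) (s : S) : M.longRunLaw π s ≤ 1 := by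
  have hsum : M.longRunLaw π ⬝ᵥ 1 = 1 := by
    refine vecMul_dotProduct_one_eq_one_rowStochastic
      (ergodicLimit_mem_rowStochastic hπ.chainMatrix_mem_rowStochastic) ?_
    rw [dotProduct_one, M.init_sum]
  rw [← hsum, dotProduct_one]
  exact Finset.single_le_sum (fun s _ => hπ.longRunLaw_nonneg s) (Finset.mem_univ s)

theorem longRunLaw_vecMul (hπ : M.IsStationaryPolicy π) :
    M.longRunLaw π ᵥ* M.chainMatrix π = M.longRunLaw π :=
  vecMul_ergodicLimit_vecMul hπ.chainMatrix_mem_rowStochastic M.init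

theorem longRunLaw_pos_iff (hπ : M.IsStationaryPolicy π) (s : S) :
    0 < M.longRunLaw π s ↔ s ∈ M.chainRecurrentSet π :=
  vecMul_ergodicLimit_pos_iff hπ.chainMatrix_mem_rowStochastic M.init_nonneg s

theorem hasOccupationMeasure (hπ : M.IsStationaryPolicy π) :
    M.HasOccupationMeasure π fun s a => M.longRunLaw π s * π s a := by
  intro s a
  have hcont : Continuous fun P : Matrix S S ℝ => (M.init ᵥ* P) s * π s a := by fun_prop
  refine ((hcont.tendsto _).comp
    (tendsto_cesaroMean hπ.chainMatrix_mem_rowStochastic)).congr fun n => ?_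
  simp only [Function.comp_apply, cesaroMean, vecMul_smul, vecMul_sum, Pi.smul_apply,
    Finset.sum_apply, smul_eq_mul, stateActionLaw, stateLaw_eq_vecMul, ← Finset.sum_mul, mul_assoc]

end IsStationaryPolicy

end LongRunLaw

namespace HasOccupationMeasure

theorem unique {p q : S → A → ℝ} (hp : M.HasOccupationMeasure π p)
    (hq : M.HasOccupationMeasure π q) : p = q :=
  funext fun s => funext fun a => tendsto_nhds_unique (hp s a) (hq s a)

theorem avgReward_eq {p : S → A → ℝ} (hp : M.HasOccupationMeasure π p) :
    M.avgReward π = M.objective p := by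
  have hlim := tendsto_finsetSum Finset.univ fun s _ =>
    tendsto_finsetSum (M.avail s) fun a _ => (hp s a).mul_const (M.meanReward s a)
  refine (hlim.congr fun n => ?_).liminf_eq
  rw [Finset.sum_comm, Finset.mul_sum]
  refine Finset.sum_congr rfl fun s _ => ?_
  rw [Finset.sum_comm, Finset.mul_sum]
  exact Finset.sum_congr rfl fun a _ => by rw [← Finset.sum_mul, mul_assoc]

end HasOccupationMeasure

theorem eq_marg_mul_of_eq_div {z : S → A → ℝ} {s : S} (hz : ∀ a ∈ M.avail s, 0 ≤ z s a)
    (hdiv : 0 < M.marg z s → ∀ a ∈ M.avail s, π s a = z s a / M.marg z s) {a : A}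
    (ha : a ∈ M.avail s) : z s a = M.marg z s * π s a := by
  have hmarg : 0 ≤ M.marg z s := Finset.sum_nonneg hz
  rcases hmarg.eq_or_lt with h0 | hpos
  · rw [← h0, zero_mul]
    exact (Finset.sum_eq_zero_iff_of_nonneg hz).1 h0.symm a ha
  · rw [hdiv hpos a ha, mul_div_cancel₀ _ hpos.ne']

theorem marg_x_pos (hx : ∀ s ∈ M.recurrentSet, ∀ a ∈ M.avail s, 0 < x s a) {s : S}
    (hs : s ∈ M.recurrentSet) : 0 < M.marg x s :=
  Finset.sum_pos (hx s hs) (M.avail_nonempty s)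

theorem IsInducedPolicy.pos (hi : M.IsInducedPolicy x y π)
    (hx : ∀ s ∈ M.recurrentSet, ∀ a ∈ M.avail s, 0 < x s a) :
    ∀ s ∈ M.recurrentSet, ∀ a ∈ M.avail s, 0 < π s a := fun s hs a ha => by
  rw [hi.of_x s (marg_x_pos hx hs) a ha]
  exact div_pos (hx s hs a ha) (marg_x_pos hx hs)

namespace MemQ0

theorem marg_x_nonneg (h : M.MemQ0 x y) (s : S) : 0 ≤ M.marg x s :=
  Finset.sum_nonneg fun a ha => (h.x_mem s a ha).1

theorem marg_x_eq_zero (h : M.MemQ0 x y) {s : S} (hs : s ∉ M.recurrentSet) :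
    M.marg x s = 0 := by
  classical
  refine (Finset.sum_eq_zero_iff_of_nonneg fun f _ => h.marg_x_nonneg f).1 h.transient s ?_
  simpa using hs

theorem x_eq (h : M.MemQ0 x y) (hi : M.IsInducedPolicy x y π) {s : S} {a : A}
    (ha : a ∈ M.avail s) : x s a = M.marg x s * π s a :=
  eq_marg_mul_of_eq_div (fun a ha => (h.x_mem s a ha).1) (hi.of_x s) ha

theorem y_eq (h : M.MemQ0 x y) (hi : M.IsInducedPolicy x y π) {s : S} {a : A}
    (hs : s ∉ M.recurrentSet) (ha : a ∈ M.avail s) : y s a = M.marg y s * π s a :=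
  eq_marg_mul_of_eq_div (h.y_nonneg s) (hi.of_y s (h.marg_x_eq_zero hs).not_gt) ha

theorem marg_x_vecMul (h : M.MemQ0 x y) (hi : M.IsInducedPolicy x y π) :
    M.marg x ᵥ* M.chainMatrix π = M.marg x := by
  funext s'
  rw [vecMul_chainMatrix, marg, ← h.stationary s']
  exact Finset.sum_congr rfl fun s _ => Finset.sum_congr rfl fun a ha => by rw [h.x_eq hi ha]

theorem sum_y_mul_T_dotProduct (h : M.MemQ0 x y) (hi : M.IsInducedPolicy x y π)
    (hx : ∀ s ∈ M.recurrentSet, ∀ a ∈ M.avail s, 0 < x s a) {k : S → ℝ}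
    (hk : M.chainMatrix π *ᵥ k = k) (s : S) :
    ∑ a ∈ M.avail s, y s a * (M.T s a ⬝ᵥ k) = M.marg y s * k s := by
  classical
  by_cases hs : s ∈ M.recurrentSet
  · have hTk (a) (ha : a ∈ M.avail s) : M.T s a ⬝ᵥ k = k s := T_dotProduct_eq ha fun s' hT =>
      harmonic_eq_of_invariant_pos hi.stationary.chainMatrix_mem_rowStochastic h.marg_x_nonneg
        (h.marg_x_vecMul hi) hk (marg_x_pos hx hs)
        (.single (chainMatrix_pos hi.stationary ha hT (hi.pos hx s hs a ha)))
    rw [marg, Finset.sum_mul]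
    exact Finset.sum_congr rfl fun a ha => by rw [hTk a ha]
  · conv_rhs => rw [← hk, chainMatrix_mulVec, Finset.mul_sum]
    exact Finset.sum_congr rfl fun a ha => by rw [h.y_eq hi hs ha, mul_assoc]

theorem marg_x_dotProduct_eq (h : M.MemQ0 x y) (hi : M.IsInducedPolicy x y π)
    (hx : ∀ s ∈ M.recurrentSet, ∀ a ∈ M.avail s, 0 < x s a) {k : S → ℝ}
    (hk : M.chainMatrix π *ᵥ k = k) : M.marg x ⬝ᵥ k = M.init ⬝ᵥ k := by
  have hbalance : M.marg y ⬝ᵥ k = M.marg x ⬝ᵥ k + M.marg y ⬝ᵥ k - M.init ⬝ᵥ k :=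
    calc M.marg y ⬝ᵥ k = ∑ s, ∑ a ∈ M.avail s, y s a * (M.T s a ⬝ᵥ k) :=
          Finset.sum_congr rfl fun s _ => (h.sum_y_mul_T_dotProduct hi hx hk s).symm
      _ = ∑ s', (∑ s, ∑ a ∈ M.avail s, y s a * M.T s a s') * k s' := (sum_flow_mul k).symm
      _ = (M.marg x + M.marg y - M.init) ⬝ᵥ k := Finset.sum_congr rfl fun s' _ => by
          rw [h.flow s', Finset.sum_add_distrib]; rfl
      _ = M.marg x ⬝ᵥ k + M.marg y ⬝ᵥ k - M.init ⬝ᵥ k := by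
          rw [sub_dotProduct, add_dotProduct]
  linarith

theorem marg_x_eq_longRunLaw [DecidableEq S] (h : M.MemQ0 x y) (hi : M.IsInducedPolicy x y π)
    (hx : ∀ s ∈ M.recurrentSet, ∀ a ∈ M.avail s, 0 < x s a) : M.marg x = M.longRunLaw π :=
  eq_vecMul_ergodicLimit hi.stationary.chainMatrix_mem_rowStochastic (h.marg_x_vecMul hi)
    fun _ hk => h.marg_x_dotProduct_eq hi hx hk

theorem mem_edgePreserving (h : M.MemQ0 x y) (hi : M.IsInducedPolicy x y π)
    (hx : ∀ s ∈ M.recurrentSet, ∀ a ∈ M.avail s, 0 < x s a) : π ∈ M.edgePreserving := by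
  classical
  refine ⟨hi.stationary, Set.ext fun s => ?_, hi.pos hx⟩
  rw [← hi.stationary.longRunLaw_pos_iff, ← h.marg_x_eq_longRunLaw hi hx]
  exact ⟨fun hs => by_contra fun hsR => (h.marg_x_eq_zero hsR).not_gt hs, marg_x_pos hx⟩

end MemQ0

theorem IsStationaryPolicy.exists_memQ0 [DecidableEq S] (hπ : M.IsStationaryPolicy π)
    (hrec : M.chainRecurrentSet π ⊆ M.recurrentSet) :
    ∃ y, M.MemQ0 (fun s a => M.longRunLaw π s * π s a) y := by
  obtain ⟨v, hv, hflow⟩ :=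
    exists_nonneg_vecMul_one_sub_eq hπ.chainMatrix_mem_rowStochastic M.init_nonneg
  refine ⟨fun s a => v s * π s a, fun s' => ?_, fun s' => ?_, ?_, fun s a ha => ?_, fun s a _ => ?_⟩
  · rw [← vecMul_chainMatrix, hπ.longRunLaw_vecMul]
    exact (congrFun (hπ.marg_mul _) s').symm
  · have hs' := congrFun hflow s'
    rw [vecMul_sub, vecMul_one, Pi.sub_apply, Pi.sub_apply] at hs'
    have hmarg (u : S → ℝ) : ∑ a ∈ M.avail s', u s' * π s' a = u s' :=
      congrFun (hπ.marg_mul u) s'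
    rw [← vecMul_chainMatrix, Finset.sum_add_distrib, hmarg, hmarg, longRunLaw]
    linarith
  · refine Finset.sum_eq_zero fun s hs => Finset.sum_eq_zero fun a _ =>
      mul_eq_zero_of_left (le_antisymm (not_lt.1 fun hpos => ?_) (hπ.longRunLaw_nonneg s)) _
    have hs' : s ∉ M.recurrentSet := by simpa using hs
    exact hs' (hrec ((hπ.longRunLaw_pos_iff s).1 hpos))
  · exact ⟨mul_nonneg (hπ.longRunLaw_nonneg s) (hπ.nonneg s a),
      mul_le_one₀ (hπ.longRunLaw_le_one s) (hπ.nonneg s a) (hπ.le_one ha)⟩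
  · exact mul_nonneg (hv s) (hπ.nonneg s a)

/-- The flow that a unit of mass at the pair `(s, a)` moves out of each state: the columns of the
flow constraint of `Q_0`, indexed by the pairs `⟨s, a⟩`. -/
def netOutflow [DecidableEq S] (M : MDP S A) (i : Σ _ : S, A) : S → ℝ :=
  Pi.single i.1 1 - M.T i.1 i.2

theorem sum_smul_netOutflow [DecidableEq S] (M : MDP S A) (y : S → A → ℝ) (s' : S) :
    (∑ i ∈ Finset.univ.sigma M.avail, y i.1 i.2 • M.netOutflow i) s' =
      M.marg y s' - ∑ s, ∑ a ∈ M.avail s, y s a * M.T s a s' := by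
  have hsingle : ∑ s, ∑ a ∈ M.avail s, y s a * (Pi.single s 1 : S → ℝ) s' = M.marg y s' := by
    simp only [← Finset.sum_mul]
    simp only [Pi.single_apply, mul_ite, mul_one, mul_zero, Fintype.sum_ite_eq, marg]
  rw [Finset.sum_sigma, Finset.sum_apply, ← hsingle, ← Finset.sum_sub_distrib]
  refine Finset.sum_congr rfl fun s _ => ?_
  rw [Finset.sum_apply, ← Finset.sum_sub_distrib]
  exact Finset.sum_congr rfl fun a _ => mul_sub _ _ _

theorem exists_flow_iff [DecidableEq S] :
    (∃ y : S → A → ℝ, (∀ s, ∀ a ∈ M.avail s, 0 ≤ y s a) ∧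
      ∀ s', ∑ s, ∑ a ∈ M.avail s, y s a * M.T s a s' =
        ∑ a ∈ M.avail s', (x s' a + y s' a) - M.init s') ↔
      M.init - M.marg x ∈
        PointedCone.hull ℝ (M.netOutflow '' (Finset.univ.sigma M.avail : Finset (Σ _ : S, A))) := by
  have hflow (y : S → A → ℝ) : (∀ s', ∑ s, ∑ a ∈ M.avail s, y s a * M.T s a s' =
        ∑ a ∈ M.avail s', (x s' a + y s' a) - M.init s') ↔
      ∑ i ∈ Finset.univ.sigma M.avail, y i.1 i.2 • M.netOutflow i = M.init - M.marg x := by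
    rw [funext_iff]
    refine forall_congr' fun s' => ?_
    rw [sum_smul_netOutflow, Finset.sum_add_distrib, Pi.sub_apply, marg, marg]
    constructor <;> intro h <;> linarith
  simp only [hflow]
  rw [mem_pointedCone_hull_image_iff]
  constructor
  · rintro ⟨y, hy, h⟩
    exact ⟨fun i => y i.1 i.2, fun i hi => hy i.1 i.2 (Finset.mem_sigma.1 hi).2, h⟩
  · rintro ⟨y, hy, h⟩
    exact ⟨fun s a => y ⟨s, a⟩, fun s a ha => hy ⟨s, a⟩ (by simpa using ha), h⟩

theorem isClosed_setOf_exists_memQ0 (M : MDP S A) : IsClosed {x | ∃ y, M.MemQ0 x y} := by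
  classical
  have hset : {x | ∃ y, M.MemQ0 x y} =
      {x | (∀ s', ∑ s, ∑ a ∈ M.avail s, x s a * M.T s a s' = ∑ a ∈ M.avail s', x s' a) ∧
        ∑ f with f ∉ M.recurrentSet, ∑ a ∈ M.avail f, x f a = 0 ∧
        ∀ s, ∀ a ∈ M.avail s, x s a ∈ Set.Icc (0 : ℝ) 1} ∩
      (fun x => M.init - M.marg x) ⁻¹' (PointedCone.hull ℝ
        (M.netOutflow '' (Finset.univ.sigma M.avail : Finset (Σ _ : S, A))) : Set (S → ℝ)) := by
    ext x
    rw [Set.mem_inter_iff, Set.mem_preimage, SetLike.mem_coe, ← exists_flow_iff]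
    constructor
    · rintro ⟨y, h⟩
      exact ⟨⟨h.stationary, by convert h.transient, h.x_mem⟩, y, h.y_nonneg, h.flow⟩
    · rintro ⟨⟨hst, htr, hx⟩, y, hy, hfl⟩
      exact ⟨y, hst, hfl, by convert htr, hx, hy⟩
  have hmarg : Continuous M.marg := continuous_pi fun s => by unfold marg; fun_prop
  rw [hset]
  refine .inter ?_ ((isClosed_pointedCone_hull_image _ _).preimage (continuous_const.sub hmarg))
  simp only [Set.ofPred_and, Set.ofPred_forall]
  exact .inter (isClosed_iInter fun s' => isClosed_eq (by fun_prop) (by fun_prop)) <|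
    .inter (isClosed_eq (by fun_prop) continuous_const) <| isClosed_iInter fun s =>
      isClosed_iInter fun a => isClosed_iInter fun _ => isClosed_Icc.preimage (by fun_prop)

theorem MemQ0.congr (h : M.MemQ0 x y) (hx : ∀ s, ∀ a ∈ M.avail s, x s a = x' s a) :
    M.MemQ0 x' y where
  stationary s' := by
    rw [← Finset.sum_congr rfl (hx s'), ← h.stationary s']
    exact Finset.sum_congr rfl fun s _ => Finset.sum_congr rfl fun a ha => by rw [hx s a ha]
  flow s' := by
    rw [h.flow s']
    exact congrArg (· - _) (Finset.sum_congr rfl fun a ha => by rw [hx s' a ha])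
  transient := by
    rw [← h.transient]
    exact Finset.sum_congr rfl fun s _ => (Finset.sum_congr rfl (hx s)).symm
  x_mem s a ha := hx s a ha ▸ h.x_mem s a ha
  y_nonneg := h.y_nonneg

theorem objective_congr (hx : ∀ s, ∀ a ∈ M.avail s, x s a = x' s a) :
    M.objective x = M.objective x' :=
  Finset.sum_congr rfl fun s _ => Finset.sum_congr rfl fun a ha => by rw [hx s a ha]

theorem MemQ0.hasOccupationMeasure (h : M.MemQ0 x y)
    (hi : M.IsInducedPolicy x y π) (hx : ∀ s ∈ M.recurrentSet, ∀ a ∈ M.avail s, 0 < x s a) :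
    M.HasOccupationMeasure π fun s a => M.marg x s * π s a := by
  classical
  rw [h.marg_x_eq_longRunLaw hi hx]
  exact hi.stationary.hasOccupationMeasure

end MDP

namespace LMDP

variable {S A : Type*} [Fintype S] {M : LMDP S A} {ε ε' : ℝ} {x y x' π : S → A → ℝ}

theorem SatisfiesSpecs.congr (h : M.SatisfiesSpecs x)
    (hx : ∀ s, ∀ a ∈ M.avail s, x s a = x' s a) : M.SatisfiesSpecs x' := fun i => by
  rw [← Finset.sum_congr rfl fun s _ => Finset.sum_congr rfl (hx s)]
  exact h i

namespace LPFeasible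

theorem mono (h : M.LPFeasible ε x y) (hε : ε' ≤ ε) : M.LPFeasible ε' x y :=
  ⟨h.memQ0, h.specs, fun s hs a ha => hε.trans (h.lower s hs a ha)⟩

theorem congr (h : M.LPFeasible ε x y) (hx : ∀ s, ∀ a ∈ M.avail s, x s a = x' s a) :
    M.LPFeasible ε x' y :=
  ⟨h.memQ0.congr hx, h.specs.congr hx, fun s hs a ha => hx s a ha ▸ h.lower s hs a ha⟩

theorem x_pos (h : M.LPFeasible ε x y) (hε : 0 < ε) :
    ∀ s ∈ M.recurrentSet, ∀ a ∈ M.avail s, 0 < x s a :=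
  fun s hs a ha => hε.trans_le (h.lower s hs a ha)

theorem mem_edgePreserving (h : M.LPFeasible ε x y) (hε : 0 < ε)
    (hi : M.IsInducedPolicy x y π) : π ∈ M.edgePreserving :=
  h.memQ0.mem_edgePreserving hi (h.x_pos hε)

theorem meetsSpecs (h : M.LPFeasible ε x y) (hε : 0 < ε) (hi : M.IsInducedPolicy x y π) :
    M.MeetsSpecs π :=
  ⟨_, h.memQ0.hasOccupationMeasure hi (h.x_pos hε), h.specs.congr fun _ _ => h.memQ0.x_eq hi⟩

theorem avgReward_eq (h : M.LPFeasible ε x y) (hε : 0 < ε) (hi : M.IsInducedPolicy x y π) :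
    M.avgReward π = M.objective x := by
  rw [(h.memQ0.hasOccupationMeasure hi (h.x_pos hε)).avgReward_eq]
  exact (MDP.objective_congr fun _ _ => h.memQ0.x_eq hi).symm

end LPFeasible

theorem isClosed_setOf_exists_lpFeasible (M : LMDP S A) (ε : ℝ) :
    IsClosed {x | ∃ y, M.LPFeasible ε x y} := by
  have hset : {x | ∃ y, M.LPFeasible ε x y} = {x | ∃ y, M.MemQ0 x y} ∩
      {x | M.SatisfiesSpecs x ∧ ∀ s ∈ M.recurrentSet, ∀ a ∈ M.avail s, ε ≤ x s a} :=
    Set.ext fun x => ⟨fun ⟨y, h⟩ => ⟨⟨y, h.memQ0⟩, h.specs, h.lower⟩,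
      fun ⟨⟨y, h⟩, hspecs, hlower⟩ => ⟨y, h, hspecs, hlower⟩⟩
  rw [hset]
  refine M.isClosed_setOf_exists_memQ0.inter ?_
  simp only [SatisfiesSpecs, Set.ofPred_and, Set.ofPred_forall]
  exact .inter
    (isClosed_iInter fun i => .inter (isClosed_le continuous_const (by fun_prop))
      (isClosed_le (by fun_prop) continuous_const))
    (isClosed_iInter fun s => isClosed_iInter fun _ => isClosed_iInter fun a =>
      isClosed_iInter fun _ => isClosed_le continuous_const (by fun_prop))

theorem LPFeasible.exists_lpOptimal (h : M.LPFeasible ε x y) : ∃ x y, M.LPOptimal ε x y := by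
  classical
  let clamp (z : S → A → ℝ) (s : S) (a : A) : ℝ := if a ∈ M.avail s then z s a else 0
  have hclamp (z : S → A → ℝ) : ∀ s, ∀ a ∈ M.avail s, z s a = clamp z s a :=
    fun s a ha => (if_pos ha).symm
  let K : Set (S → A → ℝ) := {z | ∃ w, M.LPFeasible ε z w} ∩
    Set.univ.pi fun _ => Set.univ.pi fun _ => Set.Icc 0 1
  have hK : IsCompact K := IsCompact.inter_left
    (isCompact_univ_pi fun _ => isCompact_univ_pi fun _ => isCompact_Icc)
    (M.isClosed_setOf_exists_lpFeasible ε)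
  have hmem {z w : S → A → ℝ} (hz : M.LPFeasible ε z w) : clamp z ∈ K := by
    refine ⟨⟨w, hz.congr (hclamp z)⟩, fun s _ a _ => ?_⟩
    by_cases ha : a ∈ M.avail s
    · exact hclamp z s a ha ▸ hz.memQ0.x_mem s a ha
    · simp only [clamp, if_neg ha, Set.left_mem_Icc, zero_le_one]
  have hcont : Continuous M.objective := by unfold MDP.objective; fun_prop
  obtain ⟨z, ⟨⟨w, hz⟩, -⟩, hmax⟩ := hK.exists_isMaxOn ⟨_, hmem h⟩ hcont.continuousOn
  exact ⟨z, w, hz, fun z' w' hz' =>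
    (MDP.objective_congr (hclamp z')).trans_le (hmax (hmem hz'))⟩

theorem exists_eventually_lpFeasible (hπ : π ∈ M.edgePreserving) (hspecs : M.MeetsSpecs π) :
    ∃ p y, M.HasOccupationMeasure π p ∧ ∀ᶠ ε in 𝓝[>] (0 : ℝ), M.LPFeasible ε p y := by
  classical
  obtain ⟨p, hp, hpspecs⟩ := hspecs
  obtain ⟨hstat, hrec, hpos⟩ := hπ
  obtain ⟨y, hy⟩ := hstat.exists_memQ0 hrec.subset
  have hpπ := hp.unique hstat.hasOccupationMeasure
  have hlower : ∀ᶠ ε in 𝓝[>] (0 : ℝ), ∀ s ∈ M.recurrentSet, ∀ a ∈ M.avail s, ε ≤ p s a := by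
    refine (eventually_all_finite M.recurrentSet.toFinite).2 fun s hs =>
      (eventually_all_finset _).2 fun a ha => ?_
    have hps : 0 < p s a := by
      rw [hpπ]
      exact mul_pos ((hstat.longRunLaw_pos_iff s).2 (hrec ▸ hs)) (hpos s hs a ha)
    filter_upwards [Ioc_mem_nhdsGT hps] with ε hε using hε.2
  exact ⟨p, y, hp, hlower.mono fun ε hε => ⟨hpπ ▸ hy, hpspecs, hε⟩⟩

theorem exists_lpFeasible (hπ : π ∈ M.edgePreserving) (hspecs : M.MeetsSpecs π) :
    ∃ ε : ℝ, 0 < ε ∧ ∃ p y, M.HasOccupationMeasure π p ∧ M.LPFeasible ε p y := by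
  obtain ⟨p, y, hp, h⟩ := exists_eventually_lpFeasible hπ hspecs
  obtain ⟨ε, hε, hpos⟩ := (h.and self_mem_nhdsWithin).exists
  exact ⟨ε, hpos, p, y, hp, hε⟩

theorem exists_isLUB_avgReward (h : ∃ π ∈ M.edgePreserving, M.MeetsSpecs π) :
    ∃ V, IsLUB {r : ℝ | ∃ π ∈ M.edgePreserving, M.MeetsSpecs π ∧ r = M.avgReward π} V := by
  obtain ⟨π₀, hπ₀, hspecs₀⟩ := h
  obtain ⟨ε₀, hε₀, p₀, y₀, -, h₀⟩ := exists_lpFeasible hπ₀ hspecs₀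
  obtain ⟨x, y, hopt⟩ := (h₀.mono hε₀.le).exists_lpOptimal
  refine Real.exists_isLUB ⟨_, π₀, hπ₀, hspecs₀, rfl⟩ ⟨M.objective x, ?_⟩
  rintro _ ⟨π, hπ, hspecs, rfl⟩
  obtain ⟨ε, hε, p, w, hp, h⟩ := exists_lpFeasible hπ hspecs
  exact hp.avgReward_eq.trans_le (hopt.2 p w (h.mono hε.le))

theorem eventually_avgReward_le (hπ : π ∈ M.edgePreserving) (hspecs : M.MeetsSpecs π) :
    ∀ᶠ ε in 𝓝[>] (0 : ℝ), ∀ x y, M.LPOptimal ε x y → M.avgReward π ≤ M.objective x := by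
  obtain ⟨p, y, hp, h⟩ := exists_eventually_lpFeasible hπ hspecs
  exact h.mono fun ε hε x y' hopt => hp.avgReward_eq.trans_le (hopt.2 p y hε)

end LMDP

theorem mainTheorem7 {S A : Type*} [Fintype S] (M : LMDP S A) :
    -- (1) policies obtained from feasible solutions are edge-preserving
    (∀ ε : ℝ, 0 < ε → ∀ x y π : S → A → ℝ,
      M.LPFeasible ε x y → M.IsInducedPolicy x y π → π ∈ M.edgePreserving) ∧
    -- (2) the occupation measure of an edge-preserving policy meeting the specifications
    -- is feasible for some positive ε
    (∀ π ∈ M.edgePreserving, M.MeetsSpecs π →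
      ∃ ε : ℝ, 0 < ε ∧ ∃ p y : S → A → ℝ, M.HasOccupationMeasure π p ∧ M.LPFeasible ε p y) ∧
    -- (3) if the synthesis problem is feasible, optimal solutions exist for all small ε and
    -- the rewards of the policies obtained from them tend to the supremum
    ((∃ π ∈ M.edgePreserving, M.MeetsSpecs π) →
      (∀ᶠ ε in 𝓝[>] (0 : ℝ), ∃ x y : S → A → ℝ, M.LPOptimal ε x y) ∧
      ∃ V : ℝ, IsLUB {r : ℝ | ∃ π ∈ M.edgePreserving, M.MeetsSpecs π ∧ r = M.avgReward π} V ∧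
        ∀ x y π : ℝ → S → A → ℝ,
          (∀ᶠ ε in 𝓝[>] (0 : ℝ),
            M.LPOptimal ε (x ε) (y ε) ∧ M.IsInducedPolicy (x ε) (y ε) (π ε)) →
          Tendsto (fun ε => V - M.avgReward (π ε)) (𝓝[>] 0) (𝓝 0)) := by
  refine ⟨fun ε hε x y π h hi => h.mem_edgePreserving hε hi,
    fun π hπ hspecs => LMDP.exists_lpFeasible hπ hspecs, ?_⟩
  intro hfeasible
  obtain ⟨V, hV⟩ := LMDP.exists_isLUB_avgReward hfeasible
  obtain ⟨π₀, hπ₀, hspecs₀⟩ := hfeasible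
  obtain ⟨p₀, y₀, -, h₀⟩ := LMDP.exists_eventually_lpFeasible hπ₀ hspecs₀
  refine ⟨h₀.mono fun ε hε => hε.exists_lpOptimal, V, hV, fun x y π hopt => ?_⟩
  suffices hlim : Tendsto (fun ε => M.avgReward (π ε)) (𝓝[>] 0) (𝓝 V) by
    simpa only [sub_self] using hlim.const_sub V
  refine tendsto_of_isLUB hV ?_ ?_
  · filter_upwards [hopt, self_mem_nhdsWithin] with ε ⟨ho, hi⟩ hε
    exact ⟨π ε, ho.1.mem_edgePreserving hε hi, ho.1.meetsSpecs hε hi, rfl⟩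
  · rintro _ ⟨π', hπ', hspecs', rfl⟩
    filter_upwards [LMDP.eventually_avgReward_le hπ' hspecs', hopt, self_mem_nhdsWithin]
      with ε hle ⟨ho, hi⟩ hε
    exact (hle _ _ ho).trans_eq (ho.1.avgReward_eq hε hi).symm
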